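/- **Theorem 7.12.** A *projection algebra* is a non-empty set $P$ with binary operations $\times,\star$ such that for all $e,f,g\in P$: $e\times e=e$; $(e\times f)\times e=e\times f$; $e\times(f\times g)=(e\times f)\times(f\times g)$; $(e\times f)\times g=(e\times f)\times(e\times g)$; $e\star e=e$; $f\star e=e\star(f\star e)$; $(g\star f)\star e=(g\star f)\star(f\star e)$; $g\star(f\star e)=(g\star e)\star(f\star e)$; $(e\star(f\times g))\star g=(e\star f)\star g$; $g\times((g\star f)\times e)=g\times(f\times e)$; $(e\times f)\star e=e\times f$; $f\times(e\star f)=e\star f$. It is *strong* if moreover $e\times(((e\times f)\times g)\star f)=(e\times f)\times g$ and $(f\times(g\star(f\star e)))\star e=g\star(f\star e)$ for all $e,f,g\in P$. Let $(P,\times,\star)$ be a strong projection algebra. Write $e\leq f$ if $e=f\times e$, and $p\,\mathcal F\,q$ if $p\times q=p$ and $p\star q=q$. A *$P$-path* is a tuple $\mathfrak p=(p_1,\dots,p_k)$, $k\ge 1$, with $p_1\,\mathcal F\,p_2\,\mathcal F\cdots\mathcal F\,p_k$; put $\mathbf d(\mathfrak p)=p_1$ and $\mathbf r(\mathfrak p)=p_k$.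 The $P$-paths form a category under $(p_1,\dots,p_k)\circ(q_1,\dots,q_l)=(p_1,\dots,p_k,q_2,\dots,q_l)$, defined when $p_k=q_1$. For $q\le p_1$ let ${}_q{\downharpoonleft}\mathfrak p=(q_1,\dots,q_k)$ with $q_1=q$, $q_i=q_{i-1}\star p_i$; for $q\le p_k$ let $\mathfrak p{\downharpoonright}_q=(q_1,\dots,q_k)$ with $q_k=q$, $q_i=p_i\times q_{i+1}$. Let $\approx$ be the congruence on this category generated by the pairs $((p,p),(p))$ for $p\in P$ and $((e,e\star p,f),(e,p\times f,f))$ for all $e,p,f\in P$ with $f=(e\star p)\star f$ and $e=e\times(p\times f)$. The *chain semigroup* $\mathbf S(\mathscr C(P))$ is the set of $\approx$-classes $[\mathfrak p]$ of $P$-paths with the well-defined product $$[\mathfrak p]\bullet[\mathfrak q]=\bigl[\,\mathfrak p{\downharpoonright}_{p'}\circ(p',q')\circ{}_{q'}{\downharpoonleft}\mathfrak q\,\bigr],\qquad p'=\mathbf r(\mathfrak p)\times\mathbf d(\mathfrak q),\quad q'=\mathbf r(\mathfrak p)\star\mathbf d(\mathfrak q).$$ Let $X_P=\{x_p\mid p\in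 P\}$ be an alphabet in bijection with $P$, let $X_P^+$ be the free semigroup on $X_P$, and let $R_P^\sharp$ be the congruence on $X_P^+$ generated by the relations, for all $p,q\in P$, $$x_p^2=x_p,\qquad x_{p\times q}x_q=x_px_q,\qquad x_{p\times q}x_{p\star q}=x_px_q,\qquad x_px_{p\star q}=x_px_q .$$ Then $\mathbf S(\mathscr C(P))$ has the semigroup presentation $\langle X_P: R_P\rangle$: there is an isomorphism $X_P^+/R_P^\sharp\cong\mathbf S(\mathscr C(P))$ that sends the class of $x_p$ to $[(p)]$ for every $p\in P$. -/

import Mathlib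

/-- A (two-sided) projection algebra: a set `P` with two binary operations `times` (written `×ₚ`)
and `star` (written `⋆ₚ`) such that `(P, ×ₚ)` is a left projection algebra (`L1`-`L4`),
`(P, ⋆ₚ)` is a right projection algebra (`R1`-`R4`), and the two operations are linked by
`P3`, `P3'`, `P4`, `P4'`. -/
class ProjectionAlgebra (P : Type*) where
  times : P → P → P
  star : P → P → P
  L1 : ∀ e, times e e = e
  L2 : ∀ e f, times (times e f) e = times e f
  L3 : ∀ e f g, times e (times f g) = times (times e f) (times f g)
  L4 : ∀ e f g, times (times e f) g = times (times e f) (times e g)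
  R1 : ∀ e, star e e = e
  R2 : ∀ e f, star f e = star e (star f e)
  R3 : ∀ e f g, star (star g f) e = star (star g f) (star f e)
  R4 : ∀ e f g, star g (star f e) = star (star g e) (star f e)
  P3 : ∀ e f g, star (star e (times f g)) g = star (star e f) g
  P3' : ∀ e f g, times g (times (star g f) e) = times g (times f e)
  P4 : ∀ e f, star (times e f) e = times e f
  P4' : ∀ e f, times f (star e f) = star e f

infixl:70 " ×ₚ " => ProjectionAlgebra.times
infixl:70 " ⋆ₚ " => ProjectionAlgebra.star

/-- A projection algebra is strong if it satisfies the two additional axioms `SP1`, `SP2`. -/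
class StrongProjectionAlgebra (P : Type*) extends ProjectionAlgebra P where
  SP1 : ∀ e f g : P, e ×ₚ (((e ×ₚ f) ×ₚ g) ⋆ₚ f) = (e ×ₚ f) ×ₚ g
  SP2 : ∀ e f g : P, (f ×ₚ (g ⋆ₚ (f ⋆ₚ e))) ⋆ₚ e = g ⋆ₚ (f ⋆ₚ e)

namespace ProjectionAlgebra

section Basic

variable {P : Type*} [ProjectionAlgebra P]

/-- The partial order `e ≤ f ↔ e = f ×ₚ e` of a projection algebra. -/
def Le (e f : P) : Prop := e = f ×ₚ e

/-- The relation `𝓕` on a projection algebra: `p 𝓕 q` iff `p ×ₚ q = p` and `p ⋆ₚ q = q`. -/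
def F (p q : P) : Prop := p ×ₚ q = p ∧ p ⋆ₚ q = q

/-- `(e, p, f)` is an admissible triple if `f = (e ⋆ₚ p) ⋆ₚ f` and `e = e ×ₚ (p ×ₚ f)`. -/
def Admissible (e p f : P) : Prop := f = (e ⋆ₚ p) ⋆ₚ f ∧ e = e ×ₚ (p ×ₚ f)

theorem times_times_self (e f : P) : e ×ₚ (e ×ₚ f) = e ×ₚ f := by
  have := L4 e e f
  rw [L1] at this
  exact this.symm

theorem star_star_self (e f : P) : (e ⋆ₚ f) ⋆ₚ f = e ⋆ₚ f := by
  have := R4 f f e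
  rw [R1] at this
  exact this.symm

theorem Le.refl (e : P) : Le e e := (L1 e).symm

theorem times_le (e f : P) : Le (e ×ₚ f) e := (times_times_self e f).symm

theorem star_le (e f : P) : Le (e ⋆ₚ f) f := (P4' e f).symm

theorem Le.times_right {e f : P} (h : Le e f) : e ×ₚ f = e := by
  have := L2 f e
  rwa [← h] at this

theorem Le.star_right {e f : P} (h : Le e f) : e ⋆ₚ f = e := by
  have := P4 f e
  rwa [← h] at this

theorem Le.star_left {e f : P} (h : Le e f) : f ⋆ₚ e = e := by
  have := R2 f e
  rw [h.star_right] at this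
  exact this.symm

theorem Le.trans {e f g : P} (h : Le e f) (h' : Le f g) : Le e g := by
  have := L3 g f e
  unfold Le at *
  rw [← h, ← h', ← h] at this
  exact this.symm

theorem times_star_right (e f : P) : (e ×ₚ f) ⋆ₚ f = e ⋆ₚ f := by
  have := P3 e e f
  rw [R1, (times_le e f).star_left] at this
  exact this

theorem times_star_left (e f : P) : e ×ₚ (e ⋆ₚ f) = e ×ₚ f := by
  have := P3' f f e
  rw [L1, (star_le e f).times_right] at this
  exact this

/-- `p ×ₚ q 𝓕 p ⋆ₚ q` for all `p`, `q`. -/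
theorem F_times_star (p q : P) : F (p ×ₚ q) (p ⋆ₚ q) := by
  constructor
  · rw [L4, times_star_left, L1]
  · rw [R4, times_star_right, R1]

theorem F.refl (p : P) : F p p := ⟨L1 p, R1 p⟩

end Basic

section Strong

variable {P : Type*} [StrongProjectionAlgebra P]

theorem times_star_cancel {e f g : P} (h : Le g (e ×ₚ f)) : e ×ₚ (g ⋆ₚ f) = g := by
  have := StrongProjectionAlgebra.SP1 e f g
  rwa [← h] at this

theorem star_times_cancel {e f g : P} (h : Le g (f ⋆ₚ e)) : (f ×ₚ g) ⋆ₚ e = g := by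
  have := StrongProjectionAlgebra.SP2 e f g
  rwa [h.star_right] at this

/-- `δ_{p ⋆ s} = δ_s δ_p θ_s`. -/
theorem star_times (p s t : P) : (p ⋆ₚ s) ×ₚ t = (p ×ₚ (s ×ₚ t)) ⋆ₚ s := by
  have := star_times_cancel (times_le (p ⋆ₚ s) t)
  rw [P3'] at this
  exact this.symm

/-- `θ_{s × p} = θ_s θ_p δ_s`. -/
theorem star_times' (p s t : P) : t ⋆ₚ (s ×ₚ p) = s ×ₚ ((t ⋆ₚ s) ⋆ₚ p) := by
  have := times_star_cancel (star_le t (s ×ₚ p))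
  rw [P3] at this
  exact this.symm

theorem F.restrict_left {p q t : P} (h : F p q) (ht : Le t p) : F t (t ⋆ₚ q) := by
  have h1 : p ×ₚ (t ⋆ₚ q) = t := times_star_cancel (by rw [h.1]; exact ht)
  constructor
  · rw [times_star_left]
    have := L4 p (t ⋆ₚ q) q
    rw [h1, h.1, ht.times_right] at this
    exact this
  · rw [R4, R1]

theorem F.restrict_right {p q t : P} (h : F p q) (ht : Le t q) : F (p ×ₚ t) t := by
  have h1 : (p ×ₚ t) ⋆ₚ q = t := star_times_cancel (by rw [h.2]; exact ht)
  constructor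
  · rw [L4, L1]
  · rw [times_star_right]
    have := R4 q (p ×ₚ t) p
    rw [h1, h.2, ht.star_left] at this
    exact this

/-- If `(e, p, f)` is admissible, then `e 𝓕 e ⋆ₚ p 𝓕 f`. -/
theorem Admissible.left {e p f : P} (h : Admissible e p f) :
    F e (e ⋆ₚ p) ∧ F (e ⋆ₚ p) f := by
  obtain ⟨h1, h2⟩ := h
  have h3 : e ×ₚ p = e := by
    have := L3 e p f
    rw [← h2] at this
    have h4 := L4 e p (p ×ₚ f)
    rw [← h2] at h4
    have h5 := L2 e p
    rw [← h5, ← h4]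
    exact this.symm
  refine ⟨⟨by rw [times_star_left, h3], by rw [R4, R1]⟩, ?_, h1.symm⟩
  rw [star_times, ← h2]

/-- If `(e, p, f)` is admissible, then `e 𝓕 p ×ₚ f 𝓕 f`. -/
theorem Admissible.right {e p f : P} (h : Admissible e p f) :
    F e (p ×ₚ f) ∧ F (p ×ₚ f) f := by
  obtain ⟨h1, h2⟩ := h
  have h3 : p ⋆ₚ f = f := by
    have := R3 f p e
    rw [← h1] at this
    have h4 := R4 f p (e ⋆ₚ p)
    rw [← h1] at h4
    have h5 := R2 f p
    rw [h5, ← h4]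
    exact this.symm
  refine ⟨⟨h2.symm, by rw [star_times', ← h1]⟩, by rw [L4, L1], by rw [times_star_right, h3]⟩

/-- Restriction of an admissible triple along `e' ≤ e`. -/
theorem Admissible.restrict {e p f e' : P} (h : Admissible e p f) (he : Le e' e) :
    Admissible e' p ((e' ⋆ₚ p) ⋆ₚ f) ∧
      e' ⋆ₚ (e ⋆ₚ p) = e' ⋆ₚ p ∧
      (e' ⋆ₚ (p ×ₚ f)) = p ×ₚ ((e' ⋆ₚ p) ⋆ₚ f) ∧
      (e' ⋆ₚ (p ×ₚ f)) ⋆ₚ f = (e' ⋆ₚ p) ⋆ₚ f := by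
  refine ⟨⟨?_, ?_⟩, ?_, star_times' _ _ _, P3 _ _ _⟩
  · rw [R4, R1]
  · rw [← star_times', times_star_left]
    have h1 := L4 e e' (p ×ₚ f)
    rw [← h.2, he.symm, he.times_right] at h1
    exact h1.symm
  · have h1 := R3 p e e'
    rw [he.star_right] at h1
    exact h1.symm

end Strong

end ProjectionAlgebra

open ProjectionAlgebra

/-- A `P`-path `(p₁, p₂, …, pₖ)`, `k ≥ 1`, with `p₁ 𝓕 p₂ 𝓕 ⋯ 𝓕 pₖ`; it is stored as its first
entry `p₁` and the list `[p₂, …, pₖ]` of the remaining entries. -/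
@[ext]
structure ProjectionPath (P : Type*) [ProjectionAlgebra P] where
  head : P
  tail : List P
  isChain : (head :: tail).IsChain F

namespace ProjectionPath

/-- The last entry of the nonempty list `p :: l`. -/
def lastEntry {P : Type*} : P → List P → P
  | p, [] => p
  | _, p :: l => lastEntry p l

/-- For `l = [p₂, …, pₖ]`, the list `[q₂, …, qₖ]` with `q₁ = q` and `qᵢ = qᵢ₋₁ ⋆ₚ pᵢ`. -/
def leftList {P : Type*} [ProjectionAlgebra P] : P → List P → List P
  | _, [] => []
  | q, p :: l => (q ⋆ₚ p) :: leftList (q ⋆ₚ p) l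

/-- For `p₁` and `l = [p₂, …, pₖ]`, the entry `q₁` of the sequence with `qₖ = q` and
`qᵢ = pᵢ ×ₚ qᵢ₊₁`. -/
def rightHead {P : Type*} [ProjectionAlgebra P] : P → List P → P → P
  | _, [], q => q
  | p, p' :: l, q => p ×ₚ rightHead p' l q

/-- For `l = [p₂, …, pₖ]`, the entries `[q₂, …, qₖ]` of the sequence with `qₖ = q` and
`qᵢ = pᵢ ×ₚ qᵢ₊₁`. -/
def rightTail {P : Type*} [ProjectionAlgebra P] : List P → P → List P
  | [], _ => []
  | p' :: l, q => rightHead p' l q :: rightTail l q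

section

variable {P : Type*} [StrongProjectionAlgebra P]

/-- The domain `p₁` of a path `(p₁, …, pₖ)`. -/
def dom (a : ProjectionPath P) : P := a.head

/-- The range `pₖ` of a path `(p₁, …, pₖ)`. -/
def cod (a : ProjectionPath P) : P := lastEntry a.head a.tail

/-- The path `(p)` of length one. -/
def single (p : P) : ProjectionPath P := ⟨p, [], .singleton p⟩

/-- The path `(p, q)`, where `p 𝓕 q`. -/
def pair (p q : P) (h : F p q) : ProjectionPath P := ⟨p, [q], by simpa using h⟩

/-- The path `(p, q, r)`, where `p 𝓕 q 𝓕 r`. -/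
def triple (p q r : P) (h : F p q ∧ F q r) : ProjectionPath P := ⟨p, [q, r], by simpa using h⟩

theorem isChain_append {p : P} {l m : List P} (h : (p :: l).IsChain F)
    (h' : (lastEntry p l :: m).IsChain F) : (p :: (l ++ m)).IsChain F := by
  induction l generalizing p with
  | nil => simpa [lastEntry] using h'
  | cons b l ih =>
    rw [List.isChain_cons_cons] at h
    rw [List.cons_append, List.isChain_cons_cons]
    exact ⟨h.1, ih h.2 h'⟩

theorem lastEntry_append {P : Type*} (p : P) (l m : List P) :
    lastEntry p (l ++ m) = lastEntry (lastEntry p l) m := by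
  induction l generalizing p with
  | nil => rfl
  | cons b l ih => exact ih b

/-- The composition `(p₁, …, pₖ = q₁, …, qₗ)` of two paths `(p₁, …, pₖ)` and `(q₁, …, qₗ)` with
`pₖ = q₁`. -/
def comp (a b : ProjectionPath P) (h : a.cod = b.dom) : ProjectionPath P :=
  ⟨a.head, a.tail ++ b.tail, isChain_append a.isChain (by
    have := b.isChain
    unfold cod dom at h
    rwa [h])⟩

@[simp] theorem dom_comp (a b : ProjectionPath P) (h : a.cod = b.dom) :
    (a.comp b h).dom = a.dom := rfl

@[simp] theorem cod_comp (a b : ProjectionPath P) (h : a.cod = b.dom) :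
    (a.comp b h).cod = b.cod := by
  unfold cod dom at *
  simp only [comp]
  rw [lastEntry_append, h]

theorem isChain_leftList {p q : P} {l : List P} (h : (p :: l).IsChain F) (hq : Le q p) :
    (q :: leftList q l).IsChain F := by
  induction l generalizing p q with
  | nil => exact .singleton q
  | cons b l ih =>
    rw [List.isChain_cons_cons] at h
    rw [leftList, List.isChain_cons_cons]
    exact ⟨h.1.restrict_left hq, ih h.2 (star_le q b)⟩

theorem rightHead_le {p q : P} {l : List P} (hq : Le q (lastEntry p l)) :
    Le (rightHead p l q) p := by
  cases l with
  | nil => exact hq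
  | cons b l => exact times_le _ _

theorem isChain_right {p q : P} {l : List P} (h : (p :: l).IsChain F)
    (hq : Le q (lastEntry p l)) : (rightHead p l q :: rightTail l q).IsChain F := by
  induction l generalizing p with
  | nil => exact .singleton q
  | cons b l ih =>
    rw [List.isChain_cons_cons] at h
    rw [rightHead, rightTail, List.isChain_cons_cons]
    exact ⟨h.1.restrict_right (rightHead_le hq), ih h.2 hq⟩

/-- The left restriction `(q₁, …, qₖ)` of a path `(p₁, …, pₖ)` to `q ≤ p₁`:
`q₁ = q` and `qᵢ = qᵢ₋₁ ⋆ₚ pᵢ`. -/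
def leftRestrict (q : P) (a : ProjectionPath P) (h : Le q a.dom) : ProjectionPath P :=
  ⟨q, leftList q a.tail, isChain_leftList a.isChain h⟩

/-- The right restriction `(q₁, …, qₖ)` of a path `(p₁, …, pₖ)` to `q ≤ pₖ`:
`qₖ = q` and `qᵢ = pᵢ ×ₚ qᵢ₊₁`. -/
def rightRestrict (a : ProjectionPath P) (q : P) (h : Le q a.cod) : ProjectionPath P :=
  ⟨rightHead a.head a.tail q, rightTail a.tail q, isChain_right a.isChain h⟩

@[simp] theorem dom_leftRestrict (q : P) (a : ProjectionPath P) (h : Le q a.dom) :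
    (a.leftRestrict q h).dom = q := rfl

theorem lastEntry_rightTail (p q : P) (l : List P) :
    lastEntry (rightHead p l q) (rightTail l q) = q := by
  induction l generalizing p with
  | nil => rfl
  | cons b l ih => exact ih b

@[simp] theorem cod_rightRestrict (a : ProjectionPath P) (q : P) (h : Le q a.cod) :
    (a.rightRestrict q h).cod = q := lastEntry_rightTail _ _ _

/-- The congruence `≈` on the path category generated by the pairs `((p, p), (p))`, `p ∈ P`, and
`((e, e ⋆ₚ p, f), (e, p ×ₚ f, f))`, `(e, p, f)` an admissible triple. -/
inductive Equiv : ProjectionPath P → ProjectionPath P → Prop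
  | pair (p : P) : Equiv (pair p p (F.refl p)) (single p)
  | triple (e p f : P) (h : Admissible e p f) :
      Equiv (triple e (e ⋆ₚ p) f h.left) (triple e (p ×ₚ f) f h.right)
  | refl (a : ProjectionPath P) : Equiv a a
  | symm {a b : ProjectionPath P} : Equiv a b → Equiv b a
  | trans {a b c : ProjectionPath P} : Equiv a b → Equiv b c → Equiv a c
  | comp_left (u : ProjectionPath P) {a b : ProjectionPath P} (ha : u.cod = a.dom)
      (hb : u.cod = b.dom) : Equiv a b → Equiv (u.comp a ha) (u.comp b hb)
  | comp_right (v : ProjectionPath P) {a b : ProjectionPath P} (ha : a.cod = v.dom)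
      (hb : b.cod = v.dom) : Equiv a b → Equiv (a.comp v ha) (b.comp v hb)

theorem Equiv.dom_eq {a b : ProjectionPath P} (h : Equiv a b) : a.dom = b.dom := by
  induction h with
  | symm _ ih => exact ih.symm
  | trans _ _ ih ih' => exact ih.trans ih'
  | comp_right _ _ _ _ ih => exact ih
  | _ => rfl

theorem Equiv.cod_eq {a b : ProjectionPath P} (h : Equiv a b) : a.cod = b.cod := by
  induction h with
  | symm _ ih => exact ih.symm
  | trans _ _ ih ih' => exact ih.trans ih'
  | comp_left _ _ _ _ ih => simpa using ih
  | comp_right => simp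
  | _ => rfl

theorem leftList_append (q : P) (l m : List P) :
    leftList q (l ++ m) = leftList q l ++ leftList (lastEntry q (leftList q l)) m := by
  induction l generalizing q with
  | nil => rfl
  | cons b l ih =>
    rw [List.cons_append, leftList, leftList, List.cons_append, ih]
    rfl

theorem leftList_lastEntry_le {p q : P} {l : List P} (h : Le q p) :
    Le (lastEntry q (leftList q l)) (lastEntry p l) := by
  induction l generalizing p q with
  | nil => exact h
  | cons b l ih => exact ih (star_le q b)

theorem cod_leftRestrict_le (q : P) (a : ProjectionPath P) (h : Le q a.dom) :
    Le (a.leftRestrict q h).cod a.cod := leftList_lastEntry_le h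

theorem leftRestrict_comp (q : P) (a b : ProjectionPath P) (h : a.cod = b.dom)
    (hq : Le q (a.comp b h).dom) :
    (a.comp b h).leftRestrict q hq = (a.leftRestrict q hq).comp
      (b.leftRestrict (a.leftRestrict q hq).cod (by rw [← h]; exact cod_leftRestrict_le q a hq)) rfl := by
  ext1
  · rfl
  · exact leftList_append _ _ _

theorem Equiv.comp {a a' b b' : ProjectionPath P} (ha : Equiv a a') (hb : Equiv b b')
    (h : a.cod = b.dom) (h' : a'.cod = b'.dom) : Equiv (a.comp b h) (a'.comp b' h') :=
  (Equiv.comp_right b h (ha.cod_eq ▸ h) ha).trans (Equiv.comp_left a' _ h' hb)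

theorem Equiv.of_leftRestrict (a : ProjectionPath P) {q q' : P} (hq : q = q') (h : Le q a.dom)
    (h' : Le q' a.dom) : Equiv (a.leftRestrict q h) (a.leftRestrict q' h') := by
  subst hq
  exact .refl _

theorem Equiv.leftRestrict {a b : ProjectionPath P} (h : Equiv a b) (q : P) (ha : Le q a.dom)
    (hb : Le q b.dom) : Equiv (a.leftRestrict q ha) (b.leftRestrict q hb) := by
  induction h generalizing q with
  | pair p =>
    have h1 : (ProjectionPath.pair p p (F.refl p)).leftRestrict q ha =
        ProjectionPath.pair q q (F.refl q) := by
      ext1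
      · rfl
      · exact congrArg (fun x => [x]) (Le.star_right ha)
    rw [h1]
    exact .pair q
  | triple e p f h =>
    obtain ⟨h1, h2, h3, h4⟩ := h.restrict ha
    have h5 := Equiv.triple _ _ _ h1
    convert h5 using 1
    · ext1
      · rfl
      · simp [ProjectionPath.triple, ProjectionPath.leftRestrict, leftList, h2]
    · ext1
      · rfl
      · simp [ProjectionPath.triple, ProjectionPath.leftRestrict, leftList, ← h3, h4]
  | refl a => exact .refl _
  | symm h ih => exact (ih q hb ha).symm
  | trans h h' ih ih' => exact (ih q ha (h.dom_eq ▸ ha)).trans (ih' q _ hb)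
  | comp_left u hu hv h ih =>
    rw [leftRestrict_comp, leftRestrict_comp]
    exact .comp_left _ _ _ (ih _ _ _)
  | comp_right v hu hv h ih =>
    rw [leftRestrict_comp, leftRestrict_comp]
    have h1 := ih q ha hb
    exact Equiv.comp h1 (Equiv.of_leftRestrict v h1.cod_eq _ _) _ _

theorem right_eq_left {p q : P} {l : List P} (h : (p :: l).IsChain F) (hq : Le q (lastEntry p l)) :
    rightTail l q = leftList (rightHead p l q) l := by
  induction l generalizing p with
  | nil => rfl
  | cons b l ih =>
    rw [List.isChain_cons_cons] at h
    have h1 : Le (rightHead b l q) (p ⋆ₚ b) := by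
      rw [h.1.2]
      exact rightHead_le hq
    rw [rightTail, rightHead, leftList, star_times_cancel h1, ← ih h.2 hq]

theorem left_eq_right {p q : P} {l : List P} (h : (p :: l).IsChain F) (hq : Le q p) :
    rightHead p l (lastEntry q (leftList q l)) = q := by
  induction l generalizing p q with
  | nil => rfl
  | cons b l ih =>
    rw [List.isChain_cons_cons] at h
    have h1 : Le q (p ×ₚ b) := by rwa [h.1.1]
    have h2 := ih h.2 (star_le q b)
    calc p ×ₚ rightHead b l (lastEntry (q ⋆ₚ b) (leftList (q ⋆ₚ b) l)) = p ×ₚ (q ⋆ₚ b) := by rw [h2]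
      _ = q := times_star_cancel h1

theorem rightRestrict_eq (a : ProjectionPath P) (q : P) (h : Le q a.cod) :
    a.rightRestrict q h = a.leftRestrict (a.rightRestrict q h).dom (rightHead_le h) := by
  ext1
  · rfl
  · exact right_eq_left a.isChain h

theorem leftRestrict_eq (a : ProjectionPath P) (q : P) (h : Le q a.dom) :
    a.leftRestrict q h = a.rightRestrict (a.leftRestrict q h).cod (cod_leftRestrict_le q a h) := by
  have h1 := left_eq_right a.isChain h
  rw [rightRestrict_eq]
  congr 1
  exact h1.symm

theorem Equiv.rightRestrict {a b : ProjectionPath P} (h : Equiv a b) (q : P) (ha : Le q a.cod)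
    (hb : Le q b.cod) : Equiv (a.rightRestrict q ha) (b.rightRestrict q hb) := by
  have h1 : Le (a.rightRestrict q ha).dom a.dom := rightHead_le ha
  have h2 := h.leftRestrict _ h1 (h.dom_eq ▸ h1)
  have h3 := h2.cod_eq
  rw [← rightRestrict_eq] at h2 h3
  rw [cod_rightRestrict] at h3
  rw [leftRestrict_eq] at h2
  convert h2 using 2

/-- The path `a⇂p ∘ (p, q) ∘ q⇃b` with `p = r(a) ×ₚ d(b)` and `q = r(a) ⋆ₚ d(b)`, where `r(a)` is
the range of `a` and `d(b)` is the domain of `b`. -/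
def mul (a b : ProjectionPath P) : ProjectionPath P :=
  ((a.rightRestrict (a.cod ×ₚ b.dom) (times_le _ _)).comp
    (pair (a.cod ×ₚ b.dom) (a.cod ⋆ₚ b.dom) (F_times_star _ _)) (cod_rightRestrict _ _ _)).comp
    (b.leftRestrict (a.cod ⋆ₚ b.dom) (star_le _ _)) (cod_comp _ _ _)

theorem Equiv.mul {a a' b b' : ProjectionPath P} (ha : Equiv a a') (hb : Equiv b b') :
    Equiv (a.mul b) (a'.mul b') := by
  have h1 := ha.cod_eq
  have h2 := hb.dom_eq
  unfold ProjectionPath.mul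
  apply Equiv.comp
  · apply Equiv.comp
    · convert ha.rightRestrict (a.cod ×ₚ b.dom) (times_le _ _) (h1 ▸ times_le _ _) using 2
      rw [h1, h2]
    · have h3 : ∀ (p q p' q' : P) (h : F p q) (h' : F p' q'), p = p' → q = q' →
          Equiv (ProjectionPath.pair p q h) (ProjectionPath.pair p' q' h') := by
        rintro p q _ _ h h' rfl rfl
        exact .refl _
      exact h3 _ _ _ _ _ _ (by rw [h1, h2]) (by rw [h1, h2])
  · convert hb.leftRestrict (a.cod ⋆ₚ b.dom) (star_le _ _) (h2 ▸ star_le _ _) using 2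
    rw [h1, h2]

/-- The congruence `≈` as an equivalence relation on the set of paths. -/
instance setoid (P : Type*) [StrongProjectionAlgebra P] : Setoid (ProjectionPath P) where
  r := Equiv
  iseqv := ⟨.refl, .symm, .trans⟩

end

end ProjectionPath

/-- The chain semigroup of a strong projection algebra `P`: its elements are the `≈`-classes of
paths (the morphisms of the chain category), and its product is
`[a] * [b] = [a⇂p] ∘ [p, q] ∘ [q⇃b]` with `p = r(a) ×ₚ d(b)` and `q = r(a) ⋆ₚ d(b)`. -/
def ChainSemigroup (P : Type*) [StrongProjectionAlgebra P] : Type _ :=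
  Quotient (ProjectionPath.setoid P)

namespace ChainSemigroup

variable {P : Type*} [StrongProjectionAlgebra P]

/-- The class `[a]` of a path `a`. -/
def mk (a : ProjectionPath P) : ChainSemigroup P := Quotient.mk _ a

instance : Mul (ChainSemigroup P) where
  mul := Quotient.map₂ ProjectionPath.mul fun _ _ h _ _ h' => h.mul h'

/-- The class `[p]` of the path of length one at `p`. -/
def of (p : P) : ChainSemigroup P := mk (.single p)

end ChainSemigroup

/-- The defining relations, where the letter `x_p` is `FreeSemigroup.of p`. -/
inductive ChainRelation (P : Type*) [ProjectionAlgebra P] :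
    FreeSemigroup P → FreeSemigroup P → Prop
  | r1 (p : P) : ChainRelation P (.of p * .of p) (.of p)
  | r2 (p q : P) : ChainRelation P (.of (p ×ₚ q) * .of q) (.of p * .of q)
  | r3 (p q : P) : ChainRelation P (.of (p ×ₚ q) * .of (p ⋆ₚ q)) (.of p * .of q)
  | r4 (p q : P) : ChainRelation P (.of p * .of (p ⋆ₚ q)) (.of p * .of q)

/-! ### Identities behind products with two letters. -/

namespace ProjectionAlgebra

variable {P : Type*}

/-! Reading a path `(p₁, …, pₖ)` as the word `x_{p₁} ⋯ x_{pₖ}` respects `≈` and products modulo the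
relations (`pathClass_eq`, `pathClass_mul`). Every letter is the image of a path of length one, so
this is a surjective homomorphism onto the presented semigroup.

Injectivity needs an evaluation of words that is constant on classes of the presentation and returns
`[c]` on the word of a path `c` (`mulList_mk`). Associativity of the product of paths is not
available beforehand; it comes out of the isomorphism. Words are therefore evaluated left-normed,
and each relation is checked behind an arbitrary left factor as well as on its own (`evalCon`).

Let `r` be the range of `a`. Then `[a] * [p] * [q]` is a right restriction of `a` followed by `(e,
(r ⋆ₚ p) ×ₚ q, f)`, where `e = r ×ₚ (p ×ₚ q)` and `f = (r ⋆ₚ p) ⋆ₚ q` (`mk_mul_of_of`). The triple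
`(e, p, f)` is admissible and the middle entry is `e ⋆ₚ p`, so `≈` exchanges it with `p ×ₚ f = r ⋆ₚ
(p ×ₚ q)`. The two sides of a relation between two-letter words differ at most by this exchange
(`mk_mul_of_of_eq`). -/

theorem times_times_right [ProjectionAlgebra P] (p q : P) : (p ×ₚ q) ×ₚ q = p ×ₚ q := by
  rw [L4, L1]

theorem star_star_left [ProjectionAlgebra P] (p q : P) : p ⋆ₚ (p ⋆ₚ q) = p ⋆ₚ q := by
  have h := R3 q p p
  rw [R1] at h
  exact h.symm

theorem Le.times_mono [ProjectionAlgebra P] {u v : P} (p : P) (h : Le v u) :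
    (p ×ₚ u) ×ₚ v = p ×ₚ v ∧ Le (p ×ₚ v) (p ×ₚ u) := by
  have h1 := L3 p u v
  rw [← h] at h1
  refine ⟨h1.symm, ?_⟩
  unfold Le
  rw [← L4]
  exact h1

variable [StrongProjectionAlgebra P]

/-- Needed for `x_{p × q} x_q = x_p x_q`: behind a path with range `a`, the left-hand word has this
middle entry. -/
theorem star_times_times (a p q : P) : (a ⋆ₚ (p ×ₚ q)) ×ₚ q = a ⋆ₚ (p ×ₚ q) := by
  have h1 : Le (a ⋆ₚ (p ×ₚ q)) (p ×ₚ q) := star_le _ _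
  have h2 : Le (a ⋆ₚ (p ×ₚ q)) p := h1.trans (times_le _ _)
  have h3 := L4 p (a ⋆ₚ (p ×ₚ q)) q
  rw [← h2, h1.times_right] at h3
  exact h3

/-- The entries of the paths representing `[a] * [p] * [q]` and `[a] * [p ×ₚ q] * [q]` form an
admissible triple. -/
theorem admissible_mul (a p q : P) : Admissible (a ×ₚ (p ×ₚ q)) p ((a ⋆ₚ p) ⋆ₚ q) := by
  constructor
  · rw [← star_times]
    exact (F_times_star _ _).2.symm
  · rw [← star_times']
    exact (F_times_star _ _).1.symm

theorem F_mul_left (a p q : P) : F (a ×ₚ (p ×ₚ q)) ((a ⋆ₚ p) ×ₚ q) := by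
  rw [star_times]
  exact (admissible_mul a p q).left.1

end ProjectionAlgebra

/-! ### Right restriction of composites and iterated right restriction. -/

namespace ProjectionPath

theorem rightHead_append {P : Type*} [ProjectionAlgebra P] (p q : P) (l m : List P) :
    rightHead p (l ++ m) q = rightHead p l (rightHead (lastEntry p l) m q) := by
  induction l generalizing p with
  | nil => rfl
  | cons b l ih => exact congrArg (p ×ₚ ·) (ih b)

theorem rightTail_append {P : Type*} [ProjectionAlgebra P] (p q : P) (l m : List P) :
    rightTail (l ++ m) q = rightTail l (rightHead (lastEntry p l) m q) ++ rightTail m q := by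
  induction l generalizing p with
  | nil => rfl
  | cons b l ih => exact congrArg₂ List.cons (rightHead_append b q l m) (ih b)

theorem rightHead_mono {P : Type*} [ProjectionAlgebra P] {s t : P} (h : Le t s) (p : P)
    (l : List P) : Le (rightHead p l t) (rightHead p l s) := by
  induction l generalizing p with
  | nil => exact h
  | cons b l ih => exact ((ih b).times_mono p).2

theorem rightHead_rightHead {P : Type*} [ProjectionAlgebra P] {s t : P} (h : Le t s) (p : P)
    (l : List P) : rightHead (rightHead p l s) (rightTail l s) t = rightHead p l t := by
  induction l generalizing p with
  | nil => rfl
  | cons b l ih =>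
    simp only [rightHead, rightTail, ih]
    exact ((rightHead_mono h b l).times_mono p).1

theorem rightTail_rightTail {P : Type*} [ProjectionAlgebra P] {s t : P} (h : Le t s)
    (l : List P) : rightTail (rightTail l s) t = rightTail l t := by
  induction l with
  | nil => rfl
  | cons b l ih => simp only [rightTail, ih, rightHead_rightHead h]

theorem right_lastEntry {P : Type*} [ProjectionAlgebra P] {p : P} {l : List P}
    (h : (p :: l).IsChain F) :
    rightHead p l (lastEntry p l) = p ∧ rightTail l (lastEntry p l) = l := by
  induction l generalizing p with
  | nil => exact ⟨rfl, rfl⟩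
  | cons b l ih =>
    rw [List.isChain_cons_cons] at h
    obtain ⟨h1, h2⟩ := ih h.2
    simp only [rightHead, rightTail, lastEntry, h1, h2, h.1.1, and_self]

variable {P : Type*} [StrongProjectionAlgebra P]

theorem rightRestrict_cod (a : ProjectionPath P) (h : Le a.cod a.cod) :
    a.rightRestrict a.cod h = a := by
  ext1
  · exact (right_lastEntry a.isChain).1
  · exact (right_lastEntry a.isChain).2

end ProjectionPath

/-! ### The defining relations hold behind any left factor. -/

namespace ChainSemigroup

open ProjectionPath

variable {P : Type*} [StrongProjectionAlgebra P]

theorem mk_mul_mk (a b : ProjectionPath P) : mk a * mk b = mk (a.mul b) := rfl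

theorem mk_eq {a b : ProjectionPath P} : mk a = mk b ↔ ProjectionPath.Equiv a b :=
  Quotient.eq (r := ProjectionPath.setoid P)

theorem mk_mul_of (a : ProjectionPath P) (p : P) :
    mk a * of p = mk ((a.rightRestrict (a.cod ×ₚ p) (times_le _ _)).comp
      (pair (a.cod ×ₚ p) (a.cod ⋆ₚ p) (F_times_star _ _)) (cod_rightRestrict _ _ _)) := by
  unfold of
  rw [mk_mul_mk]
  congr 1
  ext1
  · rfl
  · exact List.append_nil _

theorem of_mul_of (p q : P) :
    of p * of q = mk (pair (p ×ₚ q) (p ⋆ₚ q) (F_times_star _ _)) :=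
  mk_mul_of (single p) q

/-- The second product restricts the path of `[a] * [p]` again. Two successive restrictions of `a`
amount to one restriction to the smaller element. -/
theorem mk_mul_of_of (a : ProjectionPath P) (p q : P) :
    mk a * of p * of q =
      mk ((a.rightRestrict (a.cod ×ₚ (p ×ₚ q)) (times_le _ _)).comp
        (triple (a.cod ×ₚ (p ×ₚ q)) ((a.cod ⋆ₚ p) ×ₚ q) ((a.cod ⋆ₚ p) ⋆ₚ q)
          ⟨F_mul_left _ _ _, F_times_star _ _⟩) (cod_rightRestrict _ _ _)) := by
  rw [mk_mul_of, mk_mul_of]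
  congr 1
  have hcod : lastEntry (rightHead a.head a.tail (a.cod ×ₚ p))
      (rightTail a.tail (a.cod ×ₚ p) ++ [a.cod ⋆ₚ p]) = a.cod ⋆ₚ p := lastEntry_append _ _ _
  have hlast : lastEntry (rightHead a.head a.tail (a.cod ×ₚ p)) (rightTail a.tail (a.cod ×ₚ p)) =
      a.cod ×ₚ p := lastEntry_rightTail _ _ _
  -- The new middle entry lies below `a.cod ⋆ₚ p`, so the outer `×ₚ p` is absorbed; `P3'` then
  -- removes `a.cod ⋆ₚ`.
  have ht : (a.cod ×ₚ p) ×ₚ ((a.cod ⋆ₚ p) ×ₚ q) = a.cod ×ₚ (p ×ₚ q) := by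
    rw [((times_le (a.cod ⋆ₚ p) q).trans (star_le _ _)).times_mono a.cod |>.1, P3']
  have hle : Le (a.cod ×ₚ (p ×ₚ q)) (a.cod ×ₚ p) := ((times_le p q).times_mono a.cod).2
  ext1
  · simp only [comp, rightRestrict, pair, cod, rightHead_append] at hcod hlast ht hle ⊢
    rw [hcod, hlast]
    simp only [rightHead, ht, rightHead_rightHead hle]
  · simp only [comp, rightRestrict, pair, triple, cod] at hcod hlast ht hle ⊢
    rw [hcod, rightTail_append (rightHead a.head a.tail _), hlast]
    simp only [rightHead, rightTail, ht, rightTail_rightTail hle, List.append_assoc]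
    rfl

theorem mk_comp_congr {a a' b b' : ProjectionPath P} (ha : a = a') (hb : ProjectionPath.Equiv b b')
    (h : a.cod = b.dom) (h' : a'.cod = b'.dom) : mk (a.comp b h) = mk (a'.comp b' h') := by
  subst ha
  exact mk_eq.2 (.comp_left a h h' hb)

theorem triple_congr {e m f e' m' f' : P} (h : F e m ∧ F m f) (he : e = e') (hm : m = m')
    (hf : f = f') : triple e m f h = triple e' m' f' (he ▸ hm ▸ hf ▸ h) := by
  subst he hm hf
  rfl

/-- Products by two letters agree if the corresponding paths have the same ends and their middle
entries are equal or are exchanged by an admissible triple. -/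
theorem mk_mul_of_of_eq (a : ProjectionPath P) {p q r s : P}
    (h1 : a.cod ×ₚ (p ×ₚ q) = a.cod ×ₚ (r ×ₚ s))
    (h2 : (a.cod ⋆ₚ p) ⋆ₚ q = (a.cod ⋆ₚ r) ⋆ₚ s)
    (h3 : (a.cod ⋆ₚ r) ×ₚ s = (a.cod ⋆ₚ p) ×ₚ q ∨ (a.cod ⋆ₚ r) ×ₚ s = a.cod ⋆ₚ (p ×ₚ q)) :
    mk a * of r * of s = mk a * of p * of q := by
  rw [mk_mul_of_of, mk_mul_of_of]
  refine mk_comp_congr (by simp only [h1]) ?_ _ _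
  rcases h3 with h3 | h3
  · rw [triple_congr _ h1.symm h3 h2.symm]
    exact .refl _
  · have h := admissible_mul a.cod p q
    rw [triple_congr _ h1.symm (h3.trans (star_times' _ _ _)) h2.symm,
      triple_congr (m := (a.cod ⋆ₚ p) ×ₚ q) _ rfl (star_times _ _ _) rfl]
    exact (Equiv.triple _ _ _ h).symm

theorem mul_of_self (a : ChainSemigroup P) (p : P) : a * of p * of p = a * of p := by
  obtain ⟨a, rfl⟩ := Quotient.exists_rep a
  change mk a * of p * of p = mk a * of p
  have hp : (a.cod ⋆ₚ p) ×ₚ p = a.cod ⋆ₚ p := (star_le _ _).times_right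
  rw [mk_mul_of_of, mk_mul_of]
  -- The triple degenerates to `(e, q, q)` with `q = a.cod ⋆ₚ p`, and `(q, q) ≈ (q)` shortens it.
  have h := ProjectionPath.Equiv.comp_left (pair (a.cod ×ₚ p) (a.cod ⋆ₚ p) (F_times_star _ _))
    rfl rfl (.pair (a.cod ⋆ₚ p))
  refine mk_comp_congr (by simp only [L1]) ?_ _ _
  rw [triple_congr _ (by rw [L1]) hp (star_star_self _ _)]
  exact h

theorem mul_of_times_mul_of (a : ChainSemigroup P) (p q : P) :
    a * of (p ×ₚ q) * of q = a * of p * of q := by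
  obtain ⟨a, rfl⟩ := Quotient.exists_rep a
  exact mk_mul_of_of_eq a (by rw [times_times_right]) (P3 _ _ _).symm (.inr (star_times_times _ _ _))

theorem mul_of_times_mul_of_star (a : ChainSemigroup P) (p q : P) :
    a * of (p ×ₚ q) * of (p ⋆ₚ q) = a * of p * of q := by
  obtain ⟨a, rfl⟩ := Quotient.exists_rep a
  refine mk_mul_of_of_eq a (by rw [(F_times_star p q).1]) ?_ (.inr ?_)
  · rw [← P3, R3, times_star_right]
  -- Restricting `p ×ₚ q 𝓕 p ⋆ₚ q` to an element below `p ×ₚ q` keeps the `𝓕`-relation, which fixes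
  -- the middle entry.
  · have h := (F_times_star p q).restrict_left (star_le a.cod (p ×ₚ q))
    rw [← times_star_left]
    exact h.1

theorem mul_of_mul_of_star (a : ChainSemigroup P) (p q : P) :
    a * of p * of (p ⋆ₚ q) = a * of p * of q := by
  obtain ⟨a, rfl⟩ := Quotient.exists_rep a
  exact mk_mul_of_of_eq a (by rw [times_star_left]) (R3 _ _ _)
    (.inl (by rw [star_times, star_times, times_star_left]))

theorem pair_congr {e f e' f' : P} (h : F e f) (he : e = e') (hf : f = f') :
    pair e f h = pair e' f' (he ▸ hf ▸ h) := by
  subst he hf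
  rfl

theorem of_mul_of_eq {p q r s : P} (h1 : p ×ₚ q = r ×ₚ s) (h2 : p ⋆ₚ q = r ⋆ₚ s) :
    of p * of q = of r * of s := by
  rw [of_mul_of, of_mul_of, pair_congr _ h1 h2]

theorem of_mul_self (p : P) : of p * of p = of p := by
  rw [of_mul_of, pair_congr _ (L1 p) (R1 p)]
  exact mk_eq.2 (.pair p)

/-! ### Left-normed evaluation of words. -/

/-- Right multiplication by the letters of a list, one at a time. -/
def mulList (a : ChainSemigroup P) (l : List P) : ChainSemigroup P :=
  l.foldl (fun b p => b * of p) a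

/-- The left-normed product of the letters of a word. -/
def eval (w : FreeSemigroup P) : ChainSemigroup P := mulList (of w.head) w.tail

theorem mulList_append (a : ChainSemigroup P) (l m : List P) :
    mulList a (l ++ m) = mulList (mulList a l) m := List.foldl_append

/-- Two words are related if they have the same value and act in the same way on the chain
semigroup from the right. -/
def evalCon (P : Type*) [StrongProjectionAlgebra P] : Con (FreeSemigroup P) where
  r u v := eval u = eval v ∧
    ∀ a : ChainSemigroup P, mulList a (u.head :: u.tail) = mulList a (v.head :: v.tail)
  iseqv := ⟨fun _ => ⟨rfl, fun _ => rfl⟩, fun h => ⟨h.1.symm, fun a => (h.2 a).symm⟩,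
    fun h h' => ⟨h.1.trans h'.1, fun a => (h.2 a).trans (h'.2 a)⟩⟩
  mul' {u v u' v'} h h' := by
    constructor
    -- The value of `u * u'` is the value of `u` acted on by the letters of `u'`, so equality of
    -- values alone would not be a congruence.
    · change mulList _ (u.tail ++ u'.head :: u'.tail) = mulList _ (v.tail ++ v'.head :: v'.tail)
      rw [mulList_append, mulList_append, h'.2]
      exact congrArg (mulList · _) h.1
    · intro a
      change mulList a ((u.head :: u.tail) ++ u'.head :: u'.tail) =
        mulList a ((v.head :: v.tail) ++ v'.head :: v'.tail)
      rw [mulList_append, mulList_append, h'.2, h.2]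

theorem conGen_le_evalCon : conGen (ChainRelation P) ≤ evalCon P := by
  refine Con.conGen_le.2 fun u v h => ?_
  cases h with
  | r1 p => exact ⟨of_mul_self p, fun a => mul_of_self a p⟩
  | r2 p q =>
    exact ⟨of_mul_of_eq (times_times_right p q) (times_star_right p q),
      fun a => mul_of_times_mul_of a p q⟩
  | r3 p q =>
    exact ⟨of_mul_of_eq (F_times_star p q).1 (F_times_star p q).2,
      fun a => mul_of_times_mul_of_star a p q⟩
  | r4 p q =>
    exact ⟨of_mul_of_eq (times_star_left p q) (star_star_left p q),
      fun a => mul_of_mul_of_star a p q⟩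

/-- If `a.cod 𝓕 b`, then `a.cod ×ₚ b = a.cod` and `a.cod ⋆ₚ b = b`: nothing is restricted, and
multiplying by `[b]` only appends the entry `b`. -/
theorem mulList_mk (a : ProjectionPath P) (l : List P) (h : (a.cod :: l).IsChain F) :
    mulList (mk a) l = mk (a.comp ⟨a.cod, l, h⟩ rfl) := by
  induction l generalizing a with
  | nil =>
    refine congrArg mk ?_
    ext1
    · rfl
    · exact (List.append_nil _).symm
  | cons b l ih =>
    rw [List.isChain_cons_cons] at h
    have h1 : mk a * of b = mk (a.comp (pair a.cod b h.1) rfl) := by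
      rw [mk_mul_of]
      refine mk_comp_congr ?_ ?_ _ _
      · simp only [h.1.1, rightRestrict_cod]
      · rw [pair_congr _ h.1.1 h.1.2]
        exact .refl _
    have hc : (a.comp (pair a.cod b h.1) rfl).cod = b := cod_comp _ _ _
    change mulList (mk a * of b) l = _
    rw [h1, ih _ (by rw [hc]; exact h.2)]
    refine congrArg mk ?_
    ext1
    · rfl
    · simp [comp, pair]

/-! ### Words modulo the relations. -/

/-- The semigroup defined by the presentation. -/
abbrev Presented (P : Type*) [ProjectionAlgebra P] : Type _ := (conGen (ChainRelation P)).Quotient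

/-- The class of the word `x_p x_{p₂} ⋯ x_{pₖ}`, where `l = [p₂, …, pₖ]`. -/
def wordClass {P : Type*} [ProjectionAlgebra P] (p : P) (l : List P) : Presented P :=
  ((⟨p, l⟩ : FreeSemigroup P) : Presented P)

section Words

variable {P : Type*} [ProjectionAlgebra P]

/-- The class of a letter. -/
def letter (p : P) : Presented P := wordClass p []

theorem wordClass_cons (p q : P) (l : List P) :
    wordClass p (q :: l) = letter p * wordClass q l := rfl

theorem letter_mul_self (p : P) : letter p * letter p = letter p :=
  (Con.eq _).2 (.of _ _ (.r1 p))

theorem letter_times_mul (p q : P) : letter (p ×ₚ q) * letter q = letter p * letter q :=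
  (Con.eq _).2 (.of _ _ (.r2 p q))

theorem letter_times_mul_star (p q : P) :
    letter (p ×ₚ q) * letter (p ⋆ₚ q) = letter p * letter q :=
  (Con.eq _).2 (.of _ _ (.r3 p q))

theorem letter_mul_star (p q : P) : letter p * letter (p ⋆ₚ q) = letter p * letter q :=
  (Con.eq _).2 (.of _ _ (.r4 p q))

theorem letter_mul_wordClass (p : P) (l : List P) :
    letter p * wordClass p l = wordClass p l := by
  cases l with
  | nil => exact letter_mul_self p
  | cons b l => rw [wordClass_cons, ← mul_assoc, letter_mul_self]

/-- The endpoint shared by the two factors occurs twice on the right; idempotence of letters absorbs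
the repetition. -/
theorem wordClass_append (p : P) (l m : List P) :
    wordClass p (l ++ m) = wordClass p l * wordClass (lastEntry p l) m := by
  induction l generalizing p with
  | nil => exact (letter_mul_wordClass p m).symm
  | cons b l ih =>
    rw [List.cons_append, wordClass_cons, ih, wordClass_cons, mul_assoc]
    rfl

/-- Left restriction is invisible behind `x_p`: each `x_s x_{s ⋆ t} = x_s x_t` restores one entry,
working from the end of the word. -/
theorem letter_mul_wordClass_leftList (p q : P) (l : List P) :
    letter p * wordClass (p ⋆ₚ q) (leftList (p ⋆ₚ q) l) = letter p * wordClass q l := by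
  induction l generalizing p q with
  | nil => exact letter_mul_star p q
  | cons b l ih =>
    rw [leftList, wordClass_cons, wordClass_cons, ih, ← mul_assoc, letter_mul_star, mul_assoc]

theorem wordClass_right_mul_letter (p q : P) (l : List P) :
    wordClass (rightHead p l (lastEntry p l ×ₚ q)) (rightTail l (lastEntry p l ×ₚ q)) * letter q =
      wordClass p l * letter q := by
  induction l generalizing p with
  | nil => exact letter_times_mul p q
  | cons b l ih =>
    rw [rightHead, rightTail, lastEntry, wordClass_cons, wordClass_cons, mul_assoc, mul_assoc,
      -- Doubling the first letter of the restricted tail supplies the right neighbour that `x_{p ×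
      -- t} x_t = x_p x_t` needs.
      ← ih, ← letter_mul_wordClass (rightHead b l _), mul_assoc, ← mul_assoc, letter_times_mul,
      mul_assoc]

end Words

/-! ### The isomorphism. -/

/-- The class of the word `x_{p₁} ⋯ x_{pₖ}` of a path `(p₁, …, pₖ)`. -/
def pathClass (a : ProjectionPath P) : Presented P := wordClass a.head a.tail

theorem pathClass_comp (a b : ProjectionPath P) (h : a.cod = b.dom) :
    pathClass (a.comp b h) = pathClass a * pathClass b := by
  refine (wordClass_append _ _ _).trans ?_
  exact congrArg (fun p => wordClass a.head a.tail * wordClass p b.tail) h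

/-- For an admissible triple, both words equal `x_e x_p x_f`. -/
theorem pathClass_eq {a b : ProjectionPath P} (h : ProjectionPath.Equiv a b) :
    pathClass a = pathClass b := by
  induction h with
  | pair p => exact letter_mul_self p
  | triple e p f h =>
    change letter e * (letter (e ⋆ₚ p) * letter f) = letter e * (letter (p ×ₚ f) * letter f)
    rw [← mul_assoc, letter_mul_star, letter_times_mul, mul_assoc]
  | refl a => rfl
  | symm _ ih => exact ih.symm
  | trans _ _ ih ih' => exact ih.trans ih'
  | comp_left u _ _ _ ih => rw [pathClass_comp, pathClass_comp, ih]
  | comp_right v _ _ _ ih => rw [pathClass_comp, pathClass_comp, ih]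

theorem pathClass_mul_letter (a : ProjectionPath P) :
    pathClass a * letter a.cod = pathClass a := by
  have h := pathClass_comp a (single a.cod) rfl
  rw [← show pathClass (single a.cod) = letter a.cod from rfl, ← h]
  exact congrArg (wordClass a.head) (List.append_nil _)

theorem letter_mul_pathClass (a : ProjectionPath P) :
    letter a.dom * pathClass a = pathClass a := letter_mul_wordClass _ _

theorem pathClass_mul (a b : ProjectionPath P) :
    pathClass (a.mul b) = pathClass a * pathClass b := by
  set p := a.cod ×ₚ b.dom with hp
  set q := a.cod ⋆ₚ b.dom with hq
  set u := a.rightRestrict p (times_le _ _) with hu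
  set v := b.leftRestrict q (star_le _ _) with hv
  have h1 : pathClass u * letter b.dom = pathClass a * letter b.dom :=
    wordClass_right_mul_letter _ _ _
  have h2 : letter a.cod * pathClass v = letter a.cod * pathClass b :=
    letter_mul_wordClass_leftList _ _ _
  have h3 : pathClass u * letter p = pathClass u := by
    have := pathClass_mul_letter u
    rwa [hu, cod_rightRestrict] at this
  have h4 : letter q * pathClass v = pathClass v := letter_mul_pathClass v
  -- The link `x_p x_q` can be traded for `x_p x_{d(b)}`, whose last letter undoes the restriction
  -- of `a`. A copy of `x_{r(a)}` split off from `a` then undoes the restriction of `b`.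
  calc pathClass (a.mul b) = pathClass u * (letter p * letter q) * pathClass v := by
        refine (pathClass_comp _ _ _).trans (congrArg (· * pathClass v) ?_)
        exact pathClass_comp _ _ _
    _ = pathClass u * letter p * letter b.dom * pathClass v := by
        rw [letter_times_mul_star, ← letter_times_mul, ← mul_assoc]
    _ = pathClass a * letter a.cod * (letter b.dom * pathClass v) := by
        rw [h3, h1, pathClass_mul_letter, mul_assoc]
    _ = pathClass a * (letter a.cod * letter q * pathClass v) := by
        rw [hq, letter_mul_star]
        simp only [mul_assoc]
    _ = pathClass a * pathClass b := by
        rw [mul_assoc, h4, h2, ← mul_assoc, pathClass_mul_letter]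

/-- The homomorphism from the chain semigroup to the semigroup defined by the presentation. -/
def toPresented (P : Type*) [StrongProjectionAlgebra P] : ChainSemigroup P →ₙ* Presented P where
  toFun := Quotient.lift pathClass fun _ _ h => pathClass_eq h
  map_mul' a b := by
    obtain ⟨a, rfl⟩ := Quotient.exists_rep a
    obtain ⟨b, rfl⟩ := Quotient.exists_rep b
    exact pathClass_mul a b

theorem toPresented_of (p : P) : toPresented P (of p) = letter p := rfl

theorem toPresented_injective : Function.Injective (toPresented P) := by
  intro a b h
  obtain ⟨a, rfl⟩ := Quotient.exists_rep a
  obtain ⟨b, rfl⟩ := Quotient.exists_rep b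
  have key : ∀ c : ProjectionPath P, eval ⟨c.head, c.tail⟩ = mk c :=
    fun c => mulList_mk (single c.head) c.tail c.isChain
  have h1 := (conGen_le_evalCon ((Con.eq _).1 h)).1
  rw [key, key] at h1
  exact h1

theorem toPresented_surjective : Function.Surjective (toPresented P) := by
  have h : ∀ (l : List P) (p : P), ∃ a, toPresented P a = wordClass p l := by
    intro l
    induction l with
    | nil => exact fun p => ⟨of p, rfl⟩
    | cons q l ih =>
      intro p
      obtain ⟨a, ha⟩ := ih q
      exact ⟨of p * a, by rw [map_mul, ha, wordClass_cons, toPresented_of]⟩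
  intro w
  induction w using Con.induction_on with
  | _ w => exact h w.tail w.head

end ChainSemigroup

theorem theorem7p12 (P : Type*) [StrongProjectionAlgebra P] :
    ∃ φ : (conGen (ChainRelation P)).Quotient ≃* ChainSemigroup P,
      ∀ p : P, φ ((FreeSemigroup.of p : FreeSemigroup P) : (conGen (ChainRelation P)).Quotient) =
        ChainSemigroup.of p := by
  let e := MulEquiv.ofBijective (ChainSemigroup.toPresented P)
    ⟨ChainSemigroup.toPresented_injective, ChainSemigroup.toPresented_surjective⟩
  exact ⟨e.symm, fun p => e.symm_apply_apply (ChainSemigroup.of p)⟩
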